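/- All topological vector spaces are real and Hausdorff. An extension of topological vector spaces of $Z$ by $Y$ is a short exact sequence $0\to Y\stackrel{\imath}{\to}X\stackrel{\pi}{\to}Z\to 0$ of topological vector spaces in which $\imath$ and $\pi$ are linear, continuous and open onto their images. Two extensions $(X,\imath,\pi)$ and $(X',\imath',\pi')$ of $Z$ by $Y$ are equivalent if there is a continuous linear map $T:X\to X'$ with $T\circ\imath=\imath'$ and $\pi'\circ T=\pi$. Let $\mathrm{Ext}_{\mathrm{TVS}}(Z,Y)$ be the abelian group of equivalence classes of extensions of $Z$ by $Y$ under the Baer sum. Write $\varrho Z$ for the completion of $Z$ and $\mathcal I:Z\to\varrho Z$ for the canonical inclusion. **Theorem.** Let $Y$ and $Z$ be topological vector spaces with $Y$ complete and metrizable. Then there is an isomorphism of abelian groups $$\mathrm{Ext}_{\mathrm{TVS}}(Z,Y)\;\cong\;\mathrm{Ext}_{\mathrm{TVS}}(\varrho Z,Y),$$ whose inverse sends the class of an extension $0\to Y\to X\stackrel{\pi}{\to}\varrho Z\to 0$ to the class of its pull-back $0\to Y\to\{(x,z)\in X\times Z:\pi(x)=\mathcal I(z)\}\to Z\to 0$ along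 $\mathcal I$. -/

import Mathlib

universe u v

open Topology

/-- An extension `0 → Y → X → Z → 0` of (real, Hausdorff) topological vector spaces: a short exact
sequence of continuous linear maps which are open onto their images.
As a set `X` is in bijection with `Y × Z`, so that the universe of `X` is no restriction. -/
structure TVSExtension (Z : Type v) (Y : Type u)
    [AddCommGroup Z] [Module ℝ Z] [TopologicalSpace Z]
    [AddCommGroup Y] [Module ℝ Y] [TopologicalSpace Y] where
  X : Type (max u v)
  [addCommGroup : AddCommGroup X]
  [module : Module ℝ X]
  [topologicalSpace : TopologicalSpace X]
  [isTopologicalAddGroup : IsTopologicalAddGroup X]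
  [continuousSMul : ContinuousSMul ℝ X]
  [t2Space : T2Space X]
  incl : Y →L[ℝ] X
  proj : X →L[ℝ] Z
  /-- `incl` is injective, continuous and open onto its image. -/
  isEmbedding : IsEmbedding incl
  /-- `proj` is surjective, continuous and open. -/
  isOpenQuotientMap : IsOpenQuotientMap proj
  exact : Function.Exact incl proj

namespace TVSExtension

attribute [instance] addCommGroup module topologicalSpace isTopologicalAddGroup continuousSMul
  t2Space

section

variable {Z : Type v} [AddCommGroup Z] [Module ℝ Z] [TopologicalSpace Z]
  {Y : Type u} [AddCommGroup Y] [Module ℝ Y] [TopologicalSpace Y]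

/-- Two extensions of `Z` by `Y` are equivalent if there is a continuous linear map between the
middle spaces that is compatible with the inclusions and the projections. -/
def Equivalent (E E' : TVSExtension Z Y) : Prop :=
  ∃ T : E.X →L[ℝ] E'.X, (∀ y, T (E.incl y) = E'.incl y) ∧ ∀ x, E'.proj (T x) = E.proj x

theorem proj_incl (E : TVSExtension Z Y) (y : Y) : E.proj (E.incl y) = 0 :=
  (E.exact _).2 ⟨y, rfl⟩

theorem exists_incl_eq (E : TVSExtension Z Y) {x : E.X} (hx : E.proj x = 0) :
    ∃ y, E.incl y = x :=
  (E.exact _).1 hx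

theorem Equivalent.refl (E : TVSExtension Z Y) : E.Equivalent E :=
  ⟨ContinuousLinearMap.id ℝ E.X, fun _ => rfl, fun _ => rfl⟩

theorem Equivalent.trans {E₁ E₂ E₃ : TVSExtension Z Y} (h : E₁.Equivalent E₂)
    (h' : E₂.Equivalent E₃) : E₁.Equivalent E₃ := by
  obtain ⟨T, hT, hT'⟩ := h
  obtain ⟨S, hS, hS'⟩ := h'
  exact ⟨S.comp T, fun y => by simp [hT, hS], fun x => by simp [hT', hS']⟩

theorem bijective_of_compatible {E E' : TVSExtension Z Y} (T : E.X →L[ℝ] E'.X)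
    (hT : ∀ y, T (E.incl y) = E'.incl y) (hT' : ∀ x, E'.proj (T x) = E.proj x) :
    Function.Bijective T := by
  constructor
  · rw [injective_iff_map_eq_zero]
    intro x hx
    obtain ⟨y, rfl⟩ := E.exists_incl_eq (x := x) (by rw [← hT', hx, map_zero])
    rw [hT] at hx
    rw [E'.isEmbedding.injective (hx.trans (map_zero _).symm), map_zero]
  · intro x'
    obtain ⟨x, hx⟩ := E.isOpenQuotientMap.surjective (E'.proj x')
    obtain ⟨y, hy⟩ := E'.exists_incl_eq (x := x' - T x) (by rw [map_sub, hT', hx, sub_self])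
    exact ⟨x + E.incl y, by rw [map_add, hT, hy]; abel⟩

theorem isOpenMap_of_compatible {E E' : TVSExtension Z Y} (T : E.X →L[ℝ] E'.X)
    (hT : ∀ y, T (E.incl y) = E'.incl y) (hT' : ∀ x, E'.proj (T x) = E.proj x) :
    IsOpenMap T := by
  refine (IsTopologicalAddGroup.isOpenMap_iff_nhds_zero (f := (T : E.X →ₗ[ℝ] E'.X))).2 ?_
  intro U hU
  rw [Filter.mem_map] at hU
  obtain ⟨V, hV, hVU⟩ := exists_nhds_zero_half hU
  have h1 : E.incl ⁻¹' V ∈ 𝓝 (0 : Y) :=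
    E.incl.continuous.continuousAt.preimage_mem_nhds (by simpa using hV)
  rw [E'.isEmbedding.isInducing.nhds_eq_comap, map_zero, Filter.mem_comap] at h1
  obtain ⟨W, hW, hWV⟩ := h1
  obtain ⟨W₀, hW₀, hWsub⟩ := exists_nhds_half_neg hW
  have h2 : V ∩ T ⁻¹' W₀ ∈ 𝓝 (0 : E.X) :=
    Filter.inter_mem hV (T.continuous.continuousAt.preimage_mem_nhds (by simpa using hW₀))
  have h3 : E.proj '' (V ∩ T ⁻¹' W₀) ∈ 𝓝 (0 : Z) := by
    simpa using E.isOpenQuotientMap.isOpenMap.image_mem_nhds h2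
  have h4 : E'.proj ⁻¹' (E.proj '' (V ∩ T ⁻¹' W₀)) ∈ 𝓝 (0 : E'.X) :=
    E'.proj.continuous.continuousAt.preimage_mem_nhds (by simpa using h3)
  filter_upwards [h4, hW₀] with x' hx' hx'W
  obtain ⟨x, ⟨hxV, hxW⟩, hx⟩ := hx'
  obtain ⟨y, hy⟩ := E'.exists_incl_eq (x := x' - T x) (by rw [map_sub, hT', hx, sub_self])
  have hyV : E.incl y ∈ V := hWV (by rw [Set.mem_preimage, hy]; exact hWsub _ hx'W _ hxW)
  have := hVU _ hxV _ hyV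
  have key : T (x + E.incl y) = x' := by rw [map_add, hT, hy]; abel
  rw [← key]
  exact this

theorem Equivalent.symm {E E' : TVSExtension Z Y} (h : E.Equivalent E') : E'.Equivalent E := by
  obtain ⟨T, hT, hT'⟩ := h
  have hb := bijective_of_compatible T hT hT'
  let e : E.X ≃ₗ[ℝ] E'.X := LinearEquiv.ofBijective (T : E.X →ₗ[ℝ] E'.X) hb
  have he : ∀ x, e x = T x := fun _ => rfl
  have hc : Continuous e.symm := by
    have ho := isOpenMap_of_compatible T hT hT'
    rw [continuous_def]
    intro s hs
    have : e.symm ⁻¹' s = T '' s := by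
      ext x'
      constructor
      · intro h
        exact ⟨e.symm x', h, by rw [← he, e.apply_symm_apply]⟩
      · rintro ⟨x, hx, rfl⟩
        rw [← he]
        simpa using hx
    rw [this]
    exact ho s hs
  refine ⟨⟨e.symm.toLinearMap, hc⟩, fun y => ?_, fun x => ?_⟩
  · change e.symm _ = _
    rw [LinearEquiv.symm_apply_eq, he, hT]
  · change E.proj (e.symm x) = _
    rw [← hT', ← he, e.apply_symm_apply]

instance setoid (Z : Type v) [AddCommGroup Z] [Module ℝ Z] [TopologicalSpace Z]
    (Y : Type u) [AddCommGroup Y] [Module ℝ Y] [TopologicalSpace Y] :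
    Setoid (TVSExtension Z Y) where
  r := Equivalent
  iseqv := ⟨Equivalent.refl, Equivalent.symm, Equivalent.trans⟩

/-- The underlying space of the pull-back of `E.proj` and `t`. -/
def pullbackSpace {Z' : Type v} [AddCommGroup Z'] [Module ℝ Z'] [TopologicalSpace Z']
    (E : TVSExtension Z Y) (t : Z' →L[ℝ] Z) : Submodule ℝ (E.X × Z') where
  carrier := {p | E.proj p.1 = t p.2}
  add_mem' := by
    intro a b ha hb
    simp only [Set.mem_ofPred_eq, Prod.fst_add, Prod.snd_add, map_add] at ha hb ⊢
    rw [ha, hb]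
  zero_mem' := by simp
  smul_mem' := by
    intro c a ha
    simp only [Set.mem_ofPred_eq, Prod.smul_fst, Prod.smul_snd, map_smul] at ha ⊢
    rw [ha]

/-- The pull-back extension `E t`, whose middle space is
`{(x, z') ∈ X × Z' | proj x = t z'}`. -/
def pullback {Z' : Type v} [AddCommGroup Z'] [Module ℝ Z'] [TopologicalSpace Z']
    [IsTopologicalAddGroup Z'] [ContinuousSMul ℝ Z'] [T2Space Z']
    (E : TVSExtension Z Y) (t : Z' →L[ℝ] Z) : TVSExtension Z' Y where
  X := E.pullbackSpace t
  incl := (E.incl.prod 0).codRestrict (E.pullbackSpace t) (fun y => by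
    change E.proj (E.incl y) = t 0
    rw [E.proj_incl, map_zero])
  proj := (ContinuousLinearMap.snd ℝ E.X Z').comp (E.pullbackSpace t).subtypeL
  isEmbedding := by
    refine IsEmbedding.of_comp (ContinuousLinearMap.continuous _)
      (continuous_fst.comp continuous_subtype_val) ?_
    exact E.isEmbedding
  isOpenQuotientMap := by
    refine ⟨fun z' => ?_, ContinuousLinearMap.continuous _, fun s hs => ?_⟩
    · obtain ⟨x, hx⟩ := E.isOpenQuotientMap.surjective (t z')
      exact ⟨⟨(x, z'), hx⟩, rfl⟩
    · rw [isOpen_iff_mem_nhds]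
      rintro _ ⟨p, hp, rfl⟩
      have hs' := hs.mem_nhds hp
      rw [nhds_subtype_eq_comap, Filter.mem_comap] at hs'
      obtain ⟨w, hw, hws⟩ := hs'
      obtain ⟨a, ha, b, hb, hab⟩ := mem_nhds_prod_iff.1 hw
      have h1 : E.proj '' a ∈ 𝓝 (t p.1.2) := by
        have := E.isOpenQuotientMap.isOpenMap.image_mem_nhds ha
        rwa [show E.proj p.1.1 = t p.1.2 from p.2] at this
      have h2 := t.continuous.continuousAt.preimage_mem_nhds h1
      change _ ∈ 𝓝 p.1.2
      filter_upwards [h2, hb] with z' hz' hzb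
      obtain ⟨x, hxa, hx⟩ := hz'
      exact ⟨⟨(x, z'), hx⟩, hws (hab ⟨hxa, hzb⟩), rfl⟩
  exact := by
    rintro ⟨⟨x, z'⟩, hp⟩
    constructor
    · intro h
      change z' = 0 at h
      subst h
      obtain ⟨y, hy⟩ := E.exists_incl_eq (x := x) (by
        rw [show E.proj x = t 0 from hp, map_zero])
      exact ⟨y, Subtype.ext (Prod.ext hy rfl)⟩
    · rintro ⟨y, hy⟩
      exact (congrArg (fun p => p.1.2) hy).symm

theorem pullback_congr {Z' : Type v} [AddCommGroup Z'] [Module ℝ Z'] [TopologicalSpace Z']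
    [IsTopologicalAddGroup Z'] [ContinuousSMul ℝ Z'] [T2Space Z']
    {E E' : TVSExtension Z Y} (h : E.Equivalent E') (t : Z' →L[ℝ] Z) :
    (E.pullback t).Equivalent (E'.pullback t) := by
  obtain ⟨T, hT, hT'⟩ := h
  refine ⟨((T.prodMap (ContinuousLinearMap.id ℝ Z')).comp
    (E.pullbackSpace t).subtypeL).codRestrict (E'.pullbackSpace t) ?_, ?_, ?_⟩
  · intro p
    change E'.proj (T p.1.1) = t p.1.2
    rw [hT']
    exact p.2
  · intro y
    exact Subtype.ext (Prod.ext (hT y) rfl)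
  · intro p
    rfl

/-- The product `0 → Y₁ × Y₂ → X₁ × X₂ → Z₁ × Z₂ → 0` of two extensions. -/
def prod {Z' : Type v} [AddCommGroup Z'] [Module ℝ Z'] [TopologicalSpace Z']
    {Y' : Type u} [AddCommGroup Y'] [Module ℝ Y'] [TopologicalSpace Y']
    (E : TVSExtension Z Y) (E' : TVSExtension Z' Y') : TVSExtension (Z × Z') (Y × Y') where
  X := E.X × E'.X
  incl := E.incl.prodMap E'.incl
  proj := E.proj.prodMap E'.proj
  isEmbedding := E.isEmbedding.prodMap E'.isEmbedding
  isOpenQuotientMap := E.isOpenQuotientMap.prodMap E'.isOpenQuotientMap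
  exact := by
    rintro ⟨x, x'⟩
    constructor
    · intro h
      obtain ⟨y, hy⟩ := E.exists_incl_eq (congrArg Prod.fst h)
      obtain ⟨y', hy'⟩ := E'.exists_incl_eq (congrArg Prod.snd h)
      exact ⟨(y, y'), Prod.ext hy hy'⟩
    · rintro ⟨⟨y, y'⟩, h⟩
      rw [← h]
      exact Prod.ext (E.proj_incl y) (E'.proj_incl y')

theorem prod_congr {Z' : Type v} [AddCommGroup Z'] [Module ℝ Z'] [TopologicalSpace Z']
    {Y' : Type u} [AddCommGroup Y'] [Module ℝ Y'] [TopologicalSpace Y']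
    {E₁ E₂ : TVSExtension Z Y} {E₁' E₂' : TVSExtension Z' Y'}
    (h : E₁.Equivalent E₂) (h' : E₁'.Equivalent E₂') :
    (E₁.prod E₁').Equivalent (E₂.prod E₂') := by
  obtain ⟨T, hT, hT'⟩ := h
  obtain ⟨S, hS, hS'⟩ := h'
  exact ⟨T.prodMap S, fun y => Prod.ext (hT y.1) (hS y.2), fun x => Prod.ext (hT' x.1) (hS' x.2)⟩

/-- The subspace `{(t y, -incl y) | y ∈ Y}` of `Y' × X`. -/
def pushoutKer {Y' : Type u} [AddCommGroup Y'] [Module ℝ Y'] [TopologicalSpace Y']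
    [IsTopologicalAddGroup Y']
    (E : TVSExtension Z Y) (t : Y →L[ℝ] Y') : Submodule ℝ (Y' × E.X) :=
  LinearMap.range (t.prod (-E.incl) : Y →ₗ[ℝ] Y' × E.X)

theorem mem_pushoutKer {Y' : Type u} [AddCommGroup Y'] [Module ℝ Y'] [TopologicalSpace Y']
    [IsTopologicalAddGroup Y']
    (E : TVSExtension Z Y) (t : Y →L[ℝ] Y') (p : Y' × E.X) :
    p ∈ E.pushoutKer t ↔ ∃ y, t y = p.1 ∧ -E.incl y = p.2 := by
  constructor
  · rintro ⟨y, rfl⟩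
    exact ⟨y, rfl, rfl⟩
  · rintro ⟨y, h1, h2⟩
    exact ⟨y, Prod.ext h1 h2⟩

theorem isClosed_pushoutKer [T2Space Z] {Y' : Type u} [AddCommGroup Y'] [Module ℝ Y']
    [TopologicalSpace Y'] [IsTopologicalAddGroup Y'] [T2Space Y']
    (E : TVSExtension Z Y) (t : Y →L[ℝ] Y') :
    IsClosed (E.pushoutKer t : Set (Y' × E.X)) := by
  have hr : IsClosed (Set.range E.incl) := by
    have : Set.range E.incl = E.proj ⁻¹' {0} := by
      ext x
      exact (E.exact x).symm
    rw [this]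
    exact isClosed_singleton.preimage E.proj.continuous
  have he : IsClosedEmbedding (Prod.map (id : Y' → Y') E.incl) :=
    IsClosedEmbedding.id.prodMap ⟨E.isEmbedding, hr⟩
  have hg : IsClosed {q : Y' × Y | q.1 = -t q.2} :=
    isClosed_eq continuous_fst (t.continuous.comp continuous_snd).neg
  have : (E.pushoutKer t : Set (Y' × E.X)) =
      Prod.map (id : Y' → Y') E.incl '' {q : Y' × Y | q.1 = -t q.2} := by
    ext p
    rw [SetLike.mem_coe, mem_pushoutKer]
    constructor
    · rintro ⟨y, h1, h2⟩
      exact ⟨(p.1, -y), by simp [h1], Prod.ext rfl (by simp [← h2])⟩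
    · rintro ⟨⟨y', y⟩, h, rfl⟩
      change y' = -t y at h
      exact ⟨-y, by simp [h], by simp⟩
  rw [this]
  exact he.isClosedMap _ hg

/-- The push-out extension `t E`, whose middle space is the quotient of `Y' × X` that identifies
`(t y, 0)` with `(0, incl y)` for all `y ∈ Y`. -/
def pushout [T2Space Z] {Y' : Type u} [AddCommGroup Y'] [Module ℝ Y']
    [TopologicalSpace Y'] [IsTopologicalAddGroup Y'] [ContinuousSMul ℝ Y'] [T2Space Y']
    (E : TVSExtension Z Y) (t : Y →L[ℝ] Y') : TVSExtension Z Y' where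
  X := (Y' × E.X) ⧸ E.pushoutKer t
  t2Space :=
    haveI := E.isClosed_pushoutKer t
    inferInstance
  incl := (E.pushoutKer t).mkQL.comp (ContinuousLinearMap.inl ℝ Y' E.X)
  proj := (E.pushoutKer t).liftQL (E.proj.comp (ContinuousLinearMap.snd ℝ Y' E.X)) (by
    intro p hp
    obtain ⟨y, -, h2⟩ := (E.mem_pushoutKer t p).1 hp
    change E.proj p.2 = 0
    rw [← h2, map_neg, E.proj_incl, neg_zero])
  isEmbedding := by
    refine ⟨(IsTopologicalAddGroup.isInducing_iff_nhds_zero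
      (f := (E.pushoutKer t).mkQL.comp (ContinuousLinearMap.inl ℝ Y' E.X))).2 ?_, ?_⟩
    · refine le_antisymm (Filter.map_le_iff_le_comap.1 ?_) fun U hU => ?_
      · have := ((E.pushoutKer t).mkQL.comp
          (ContinuousLinearMap.inl ℝ Y' E.X)).continuous.tendsto 0
        rwa [map_zero] at this
      · obtain ⟨V, hV, hVU⟩ := exists_nhds_zero_half hU
        have h1 : t ⁻¹' V ∈ 𝓝 (0 : Y) :=
          t.continuous.continuousAt.preimage_mem_nhds (by simpa using hV)
        rw [E.isEmbedding.isInducing.nhds_eq_comap, map_zero, Filter.mem_comap] at h1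
        obtain ⟨W, hW, hWV⟩ := h1
        have h2 : (E.pushoutKer t).mkQ '' (V ×ˢ W) ∈ 𝓝 0 := by
          have := (E.pushoutKer t).isOpenMap_mkQ.image_mem_nhds
            (prod_mem_nhds (x := (0 : Y')) (y := (0 : E.X)) hV hW)
          rwa [← Prod.zero_eq_mk, map_zero] at this
        refine Filter.mem_comap.2 ⟨_, h2, ?_⟩
        rintro y' ⟨⟨v, w⟩, ⟨hv, hw⟩, hvw⟩
        have hd := (Submodule.Quotient.eq (E.pushoutKer t)).1
          (show Submodule.Quotient.mk (y', (0 : E.X)) = Submodule.Quotient.mk (v, w) from hvw.symm)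
        obtain ⟨y, hy1, hy2⟩ := (E.mem_pushoutKer t _).1 hd
        change t y = y' - v at hy1
        change -E.incl y = 0 - w at hy2
        have hyw : E.incl y = w := by simpa using hy2
        have hty : t y ∈ V := hWV (by rw [Set.mem_preimage, hyw]; exact hw)
        have := hVU v hv _ hty
        rwa [hy1, add_sub_cancel] at this
    · rw [injective_iff_map_eq_zero]
      intro y' hy'
      obtain ⟨y, hy1, hy2⟩ := (E.mem_pushoutKer t _).1
        ((Submodule.Quotient.mk_eq_zero (E.pushoutKer t)).1
          (show Submodule.Quotient.mk (y', (0 : E.X)) = 0 from hy'))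
      change t y = y' at hy1
      change -E.incl y = 0 at hy2
      have h0 : y = 0 := E.isEmbedding.injective (by rw [map_zero]; simpa using hy2)
      rw [← hy1, h0, map_zero]
  isOpenQuotientMap := by
    refine IsOpenQuotientMap.of_comp (E.pushoutKer t).mkQL.continuous
      (E.pushoutKer t).isOpenQuotientMap_mkQ.surjective (ContinuousLinearMap.continuous _) ?_
    exact E.isOpenQuotientMap.comp ⟨Prod.snd_surjective, continuous_snd, isOpenMap_snd⟩
  exact := by
    intro q
    obtain ⟨⟨y', x⟩, rfl⟩ := (E.pushoutKer t).mkQ_surjective q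
    constructor
    · intro h
      obtain ⟨y, rfl⟩ := E.exists_incl_eq (x := x) h
      refine ⟨y' + t y, ?_⟩
      refine (Submodule.Quotient.eq (E.pushoutKer t)).2 ((E.mem_pushoutKer t _).2 ⟨y, ?_, ?_⟩)
      · change t y = y' + t y - y'
        abel
      · change -E.incl y = 0 - E.incl y
        abel
    · rintro ⟨y, hy⟩
      rw [← hy]
      exact map_zero E.proj

theorem pushout_congr [T2Space Z] {Y' : Type u} [AddCommGroup Y'] [Module ℝ Y']
    [TopologicalSpace Y'] [IsTopologicalAddGroup Y'] [ContinuousSMul ℝ Y'] [T2Space Y']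
    {E E' : TVSExtension Z Y} (h : E.Equivalent E') (t : Y →L[ℝ] Y') :
    (E.pushout t).Equivalent (E'.pushout t) := by
  obtain ⟨T, hT, hT'⟩ := h
  refine ⟨(E.pushoutKer t).liftQL ((E'.pushoutKer t).mkQL.comp
    ((ContinuousLinearMap.id ℝ Y').prodMap T)) ?_, ?_, ?_⟩
  · intro p hp
    obtain ⟨y, h1, h2⟩ := (E.mem_pushoutKer t p).1 hp
    refine (Submodule.Quotient.mk_eq_zero (E'.pushoutKer t)).2
      ((E'.mem_pushoutKer t _).2 ⟨y, h1, ?_⟩)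
    change -E'.incl y = T p.2
    rw [← h2, map_neg, hT]
  · intro y'
    change (E'.pushoutKer t).mkQ (y', T 0) = (E'.pushoutKer t).mkQ (y', 0)
    rw [map_zero]
  · intro q
    obtain ⟨⟨y', x⟩, rfl⟩ := (E.pushoutKer t).mkQ_surjective q
    exact hT' x

/-- The Baer sum `∇ ((E₁ × E₂) Δ)`, where `Δ z = (z, z)` and `∇ (y, y') = y + y'`. -/
def baerSum [IsTopologicalAddGroup Z] [ContinuousSMul ℝ Z] [T2Space Z]
    [IsTopologicalAddGroup Y] [ContinuousSMul ℝ Y] [T2Space Y]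
    (E₁ E₂ : TVSExtension Z Y) : TVSExtension Z Y :=
  ((E₁.prod E₂).pullback
    ((ContinuousLinearMap.id ℝ Z).prod (ContinuousLinearMap.id ℝ Z))).pushout
    (ContinuousLinearMap.fst ℝ Y Y + ContinuousLinearMap.snd ℝ Y Y)

theorem baerSum_congr [IsTopologicalAddGroup Z] [ContinuousSMul ℝ Z] [T2Space Z]
    [IsTopologicalAddGroup Y] [ContinuousSMul ℝ Y] [T2Space Y]
    {E₁ E₁' E₂ E₂' : TVSExtension Z Y} (h₁ : E₁.Equivalent E₁') (h₂ : E₂.Equivalent E₂') :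
    (E₁.baerSum E₂).Equivalent (E₁'.baerSum E₂') :=
  pushout_congr (pullback_congr (prod_congr h₁ h₂) _) _

end

end TVSExtension

/-- `Ext_TVS(Z, Y)`: the equivalence classes of extensions `0 → Y → X → Z → 0`. -/
def ExtTVS (Z : Type v) [AddCommGroup Z] [Module ℝ Z] [TopologicalSpace Z]
    (Y : Type u) [AddCommGroup Y] [Module ℝ Y] [TopologicalSpace Y] : Type (max u v + 1) :=
  Quotient (TVSExtension.setoid Z Y)

namespace ExtTVS

variable {Z : Type v} [AddCommGroup Z] [Module ℝ Z] [TopologicalSpace Z]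
  {Y : Type u} [AddCommGroup Y] [Module ℝ Y] [TopologicalSpace Y]

/-- The class of an extension. -/
def mk (E : TVSExtension Z Y) : ExtTVS Z Y :=
  Quotient.mk (TVSExtension.setoid Z Y) E

/-- The group operation of `Ext_TVS(Z, Y)` is induced by the Baer sum. -/
instance [IsTopologicalAddGroup Z] [ContinuousSMul ℝ Z] [T2Space Z]
    [IsTopologicalAddGroup Y] [ContinuousSMul ℝ Y] [T2Space Y] : Add (ExtTVS Z Y) where
  add := Quotient.map₂ TVSExtension.baerSum fun _ _ h₁ _ _ h₂ => TVSExtension.baerSum_congr h₁ h₂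

end ExtTVS

section Completion

open UniformSpace

variable (Z : Type v) [AddCommGroup Z] [Module ℝ Z] [UniformSpace Z] [IsUniformAddGroup Z]
  [ContinuousSMul ℝ Z]

instance uniformContinuousConstSMul_of_tvs : UniformContinuousConstSMul ℝ Z :=
  uniformContinuousConstSMul_of_continuousConstSMul ℝ Z

/-- The completion of a topological vector space is a topological vector space. -/
instance continuousSMul_completion : ContinuousSMul ℝ (Completion Z) where
  continuous_smul := by
    have de : IsDenseInducing (AddMonoidHom.id ℝ) :=
      ⟨IsInducing.id, Function.surjective_id.denseRange⟩
    have df : IsDenseInducing (Completion.toCompl : Z →+ Completion Z) :=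
      Completion.isDenseInducing_toCompl Z
    let φ : ℝ →+ Z →+ Completion Z :=
      AddMonoidHom.mk' (fun r => Completion.toCompl.comp (DistribSMul.toAddMonoidHom Z r))
        (fun a b => by ext z; simp [add_smul, Completion.coe_add])
    have hφ : Continuous fun p : ℝ × Z => φ p.1 p.2 :=
      (Completion.continuous_coe Z).comp continuous_smul
    have key := de.extend_Z_bilin df hφ
    convert key using 1
    funext p
    obtain ⟨r, x⟩ := p
    refine Completion.induction_on x (isClosed_eq (continuous_const_smul r)
      (key.comp (Continuous.prodMk_right r))) fun z => ?_
    have := (de.prodMap df).extend_eq hφ (r, z)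
    exact (Completion.coe_smul r z).symm.trans this.symm

/-- The canonical inclusion of a topological vector space into its completion. -/
def completionInclusion : Z →L[ℝ] Completion Z where
  toFun z := z
  map_add' := Completion.coe_add
  map_smul' := Completion.coe_smul
  cont := Completion.continuous_coe Z

end Completion

/-! Pulling back along `completionInclusion Z` is additive because pull-backs commute with products
and push-outs (`baerSum_pullback_equivalent`). It remains to see that it is bijective on classes.

Surjectivity: complete the middle space and obtain `0 → Y → ϱX → ϱZ → 0`. A complete `Y` stays
closed in `ϱX`, and approximating a kernel element by points of `X` puts it in the closure of `Y`,
hence in `Y` (`exact_completionMap`). The delicate point is that `ϱX → ϱZ` is onto and open. This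
needs Cauchy filters of `Z` to lift to `X`, and `exists_cauchy_lift` does so when `Y` is first
countable: only the ambiguity in `Y` has to be controlled, and a sequence of neighborhoods suffices
for that, although `X` and `Z` may be far from metrizable. The original extension then maps to the
pull-back of the completed one by `x ↦ (x, p x)`.

Injectivity: over a complete base the middle space is complete (`completeSpace_of_exact`), and the
pull-back is dense in it. So an equivalence of pull-backs extends by continuity; metrizability plays
no role here. -/

namespace TVSExtension

/-! ### Pull-back and the Baer sum -/

section BaseChange

variable {Z Z' : Type v} [AddCommGroup Z] [Module ℝ Z] [TopologicalSpace Z]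
  [AddCommGroup Z'] [Module ℝ Z'] [TopologicalSpace Z']
  [IsTopologicalAddGroup Z'] [ContinuousSMul ℝ Z'] [T2Space Z']
  {Y Y' : Type u} [AddCommGroup Y] [Module ℝ Y] [TopologicalSpace Y]
  [AddCommGroup Y'] [Module ℝ Y'] [TopologicalSpace Y']
  [IsTopologicalAddGroup Y'] [ContinuousSMul ℝ Y'] [T2Space Y']

theorem proj_eq_of_mem_pullback (E : TVSExtension Z Y) (t : Z' →L[ℝ] Z) (p : (E.pullback t).X) :
    E.proj p.1.1 = t p.1.2 :=
  p.2

/-- The first projection from the middle space of a pull-back. -/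
def pullbackFst (E : TVSExtension Z Y) (t : Z' →L[ℝ] Z) : (E.pullback t).X →L[ℝ] E.X :=
  (ContinuousLinearMap.fst ℝ E.X Z').comp (E.pullbackSpace t).subtypeL

theorem range_pullbackFst (E : TVSExtension Z Y) (t : Z' →L[ℝ] Z) :
    Set.range (E.pullbackFst t) = E.proj ⁻¹' Set.range t := by
  ext x
  constructor
  · rintro ⟨p, rfl⟩
    exact ⟨p.1.2, (E.proj_eq_of_mem_pullback t p).symm⟩
  · rintro ⟨z, hz⟩
    exact ⟨⟨(x, z), hz.symm⟩, rfl⟩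

/-- On the pull-back, `t z'` is a continuous function of `x`, namely `proj x`. So the topology
induced by `x` already contains the one induced by `z' ↦ t z'`, which is that of `Z'` when `t` is
inducing. -/
theorem isInducing_pullbackFst (E : TVSExtension Z Y) {t : Z' →L[ℝ] Z} (ht : IsInducing t) :
    IsInducing (E.pullbackFst t) := by
  refine IsInducing.of_comp (g := fun x => (x, E.proj x)) (E.pullbackFst t).continuous
    (by fun_prop) ?_
  have h : IsInducing fun q : (E.pullback t).X => (q.1.1, t q.1.2) :=
    (IsInducing.id.prodMap ht).comp IsInducing.subtypeVal
  convert h using 1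
  funext q
  exact Prod.ext rfl (E.proj_eq_of_mem_pullback t q)

/-- The middle space of a pull-back is a categorical pull-back. -/
def pullbackLift {W : Type*} [AddCommGroup W] [Module ℝ W] [TopologicalSpace W]
    (E : TVSExtension Z Y) (t : Z' →L[ℝ] Z) (f : W →L[ℝ] E.X) (g : W →L[ℝ] Z')
    (h : ∀ w, E.proj (f w) = t (g w)) : W →L[ℝ] (E.pullback t).X :=
  (f.prod g).codRestrict (E.pullbackSpace t) h

/-- Push-out and pull-back of extensions commute up to equivalence. -/
theorem pullback_pushout_equivalent [T2Space Z] (E : TVSExtension Z Y) (t : Z' →L[ℝ] Z)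
    (s : Y →L[ℝ] Y') :
    ((E.pullback t).pushout s).Equivalent ((E.pushout s).pullback t) := by
  -- The map is `[y', (x, z')] ↦ ([y', x], z')`. No inverse is needed: any compatible map is an
  -- equivalence.
  refine ⟨pullbackLift (E.pushout s) t (((E.pullback t).pushoutKer s).liftQL
    ((E.pushoutKer s).mkQL.comp
      ((ContinuousLinearMap.id ℝ Y').prodMap (E.pullbackFst t))) ?_)
    ((E.pullback t).pushout s).proj ?_, ?_, ?_⟩
  · intro p hp
    obtain ⟨y, h1, h2⟩ := ((E.pullback t).mem_pushoutKer s p).1 hp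
    refine (Submodule.Quotient.mk_eq_zero (E.pushoutKer s)).2
      ((E.mem_pushoutKer s _).2 ⟨y, h1, ?_⟩)
    change _ = E.pullbackFst t p.2
    rw [← h2, map_neg]
    rfl
  · intro q
    obtain ⟨⟨y', p⟩, rfl⟩ := ((E.pullback t).pushoutKer s).mkQ_surjective q
    exact E.proj_eq_of_mem_pullback t p
  · intro y'
    exact Subtype.ext (Prod.ext rfl rfl)
  · intro q
    rfl

/-- Both middle spaces consist of pairs `(x, x')` lying over the same `t z'`; the equivalence only
rearranges coordinates. -/
theorem prod_pullback_diag_equivalent [IsTopologicalAddGroup Z] [ContinuousSMul ℝ Z] [T2Space Z]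
    (E E' : TVSExtension Z Y) (t : Z' →L[ℝ] Z) :
    (((E.pullback t).prod (E'.pullback t)).pullback
      ((ContinuousLinearMap.id ℝ Z').prod (ContinuousLinearMap.id ℝ Z'))).Equivalent
    (((E.prod E').pullback
      ((ContinuousLinearMap.id ℝ Z).prod (ContinuousLinearMap.id ℝ Z))).pullback t) := by
  let F := (E.pullback t).prod (E'.pullback t)
  let Δ' := (ContinuousLinearMap.id ℝ Z').prod (ContinuousLinearMap.id ℝ Z')
  refine ⟨pullbackLift _ t (pullbackLift (E.prod E') _
    (((E.pullbackFst t).prodMap (E'.pullbackFst t)).comp (F.pullbackFst Δ'))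
    (t.comp (F.pullback Δ').proj) ?_) (F.pullback Δ').proj ?_, ?_, ?_⟩
  · intro p
    have h := F.proj_eq_of_mem_pullback Δ' p
    have h1 : p.1.1.1.1.2 = p.1.2 := congrArg Prod.fst h
    have h2 : p.1.1.2.1.2 = p.1.2 := congrArg Prod.snd h
    refine Prod.ext ?_ ?_
    · exact (E.proj_eq_of_mem_pullback t p.1.1.1).trans (congrArg t h1)
    · exact (E'.proj_eq_of_mem_pullback t p.1.1.2).trans (congrArg t h2)
  · intro p
    rfl
  · intro y
    refine Subtype.ext (Prod.ext (Subtype.ext (Prod.ext rfl ?_)) rfl)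
    exact map_zero t
  · intro p
    rfl

theorem baerSum_pullback_equivalent [IsTopologicalAddGroup Z] [ContinuousSMul ℝ Z] [T2Space Z]
    (E E' : TVSExtension Z Y') (t : Z' →L[ℝ] Z) :
    ((E.pullback t).baerSum (E'.pullback t)).Equivalent ((E.baerSum E').pullback t) :=
  (pushout_congr (prod_pullback_diag_equivalent E E' t) _).trans
    (pullback_pushout_equivalent _ t _)

end BaseChange

end TVSExtension

namespace ExtTVS

variable {Z Z' : Type v} [AddCommGroup Z] [Module ℝ Z] [TopologicalSpace Z]
  [IsTopologicalAddGroup Z] [ContinuousSMul ℝ Z] [T2Space Z]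
  [AddCommGroup Z'] [Module ℝ Z'] [TopologicalSpace Z']
  [IsTopologicalAddGroup Z'] [ContinuousSMul ℝ Z'] [T2Space Z']
  {Y : Type u} [AddCommGroup Y] [Module ℝ Y] [TopologicalSpace Y]
  [IsTopologicalAddGroup Y] [ContinuousSMul ℝ Y] [T2Space Y]

/-- Pull-back of classes of extensions along a continuous linear map. -/
def pullback (t : Z' →L[ℝ] Z) : AddHom (ExtTVS Z Y) (ExtTVS Z' Y) where
  toFun := Quotient.map (fun E => TVSExtension.pullback E t)
    fun _ _ h => TVSExtension.pullback_congr h t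
  map_add' := by
    rintro ⟨E⟩ ⟨E'⟩
    exact Quotient.sound (TVSExtension.baerSum_pullback_equivalent E E' t).symm

theorem pullback_mk (t : Z' →L[ℝ] Z) (E : TVSExtension Z Y) :
    pullback t (mk E) = mk (E.pullback t) :=
  rfl

end ExtTVS

/-! ### Lifting Cauchy filters -/

section Lifting

open Filter

/-- The five terms are those of the Cauchy estimate in `exists_cauchy_lift`: two for each of the
points compared, one for a correction lifted from the quotient. -/
theorem exists_nhds_zero_five {X : Type*} [AddCommGroup X] [TopologicalSpace X]
    [IsTopologicalAddGroup X] {U : Set X} (hU : U ∈ 𝓝 0) :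
    ∃ V ∈ 𝓝 (0 : X), (∀ a ∈ V, ∀ b ∈ V, a + b ∈ U) ∧
      ∀ a ∈ V, ∀ b ∈ V, ∀ c ∈ V, ∀ d ∈ V, ∀ e ∈ V, (a + b) - (c + d) - e ∈ U := by
  obtain ⟨V₁, hV₁, h₁⟩ := exists_nhds_half_neg hU
  obtain ⟨V₂, hV₂, h₂⟩ := exists_nhds_half_neg hV₁
  obtain ⟨V₃, hV₃, h₃⟩ := exists_nhds_zero_half (inter_mem hU hV₂)
  refine ⟨V₃ ∩ V₁, inter_mem hV₃ hV₁, fun a ha b hb => (h₃ a ha.1 b hb.1).1, ?_⟩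
  intro a ha b hb c hc d hd e he
  exact h₁ _ (h₂ _ (h₃ a ha.1 b hb.1).2 _ (h₃ c hc.1 d hd.1).2) _ he.2

variable {X Y Z : Type*} [AddCommGroup X] [TopologicalSpace X] [IsTopologicalAddGroup X]
  [AddCommGroup Y] [TopologicalSpace Y] [FirstCountableTopology Y]

/-- A neighborhood of `0` contains a sequence of rapidly shrinking neighborhoods which is
a neighborhood basis on a first countable subgroup. -/
theorem exists_seq_nhds_zero (i : Y →+ X) (hi : IsInducing i) {U : Set X} (hU : U ∈ 𝓝 0) :
    ∃ V : ℕ → Set X, (∀ n, V n ∈ 𝓝 0) ∧ (∀ a ∈ V 0, ∀ b ∈ V 0, a + b ∈ U) ∧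
      (∀ n, ∀ a ∈ V (n + 1), ∀ b ∈ V (n + 1), a + b ∈ V n) ∧
      ∀ W ∈ 𝓝 (0 : X), ∃ n, ∀ a ∈ V n, ∀ b ∈ V n, ∀ c ∈ V n, ∀ d ∈ V n, ∀ e ∈ V n, ∀ y,
        i y = (a + b) - (c + d) - e → i y ∈ W := by
  obtain ⟨B, hB⟩ := (𝓝 (0 : Y)).exists_antitone_basis
  have hB' : ∀ n, ∃ S ∈ 𝓝 (0 : X), i ⁻¹' S ⊆ B n := fun n => by
    have := hB.1.mem_of_mem (i := n) trivial
    rwa [hi.nhds_eq_comap, map_zero, mem_comap] at this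
  choose S hS hSB using hB'
  have step : ∀ (n : ℕ) (A : {A : Set X // A ∈ 𝓝 0}), ∃ A' : {A : Set X // A ∈ 𝓝 0},
      (∀ a ∈ A'.1, ∀ b ∈ A'.1, a + b ∈ A.1) ∧
      ∀ a ∈ A'.1, ∀ b ∈ A'.1, ∀ c ∈ A'.1, ∀ d ∈ A'.1, ∀ e ∈ A'.1,
        (a + b) - (c + d) - e ∈ S n := fun n A => by
    obtain ⟨V, hV, h1, h2⟩ := exists_nhds_zero_five (inter_mem A.2 (hS n))
    exact ⟨⟨V, hV⟩, fun a ha b hb => (h1 a ha b hb).1,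
      fun a ha b hb c hc d hd e he => (h2 a ha b hb c hc d hd e he).2⟩
  choose f hf1 hf2 using step
  obtain ⟨V₀, hV₀, hV₀U⟩ := exists_nhds_zero_half hU
  let V : ℕ → {A : Set X // A ∈ 𝓝 0} := fun n => Nat.rec ⟨V₀, hV₀⟩ f n
  refine ⟨fun n => (V n).1, fun n => (V n).2, hV₀U, fun n => hf1 n (V n), fun W hW => ?_⟩
  have hW' : i ⁻¹' W ∈ 𝓝 (0 : Y) := by
    rw [hi.nhds_eq_comap, map_zero]
    exact preimage_mem_comap hW
  obtain ⟨n, -, hn⟩ := hB.1.mem_iff.1 hW'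
  -- The index shifts by one because `V (n + 1) = f n (V n)` is the set adapted to `S n`.
  refine ⟨n + 1, fun a ha b hb c hc d hd e he y hy => hn (hSB n ?_)⟩
  rw [Set.mem_preimage, hy]
  exact hf2 n (V n) a ha b hb c hc d hd e he

variable [AddCommGroup Z] [TopologicalSpace Z]

/-- Lifting of Cauchy filters along an open homomorphism with first countable kernel. -/
theorem exists_cauchy_lift (i : Y →+ X) (hi : IsInducing i) (p : X →+ Z)
    (hp : ∀ U ∈ 𝓝 (0 : X), p '' U ∈ 𝓝 0) (hex : ∀ x, p x = 0 → ∃ y, i y = x)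
    (F : Filter Z) (hF : ∀ N ∈ 𝓝 (0 : Z), ∃ A ∈ F, ∀ a ∈ A, ∀ b ∈ A, a - b ∈ N)
    {S : Set X} (hS : ∀ A ∈ F, ∃ x ∈ S, p x ∈ A) {U : Set X} (hU : U ∈ 𝓝 0) :
    ∃ H : Filter X, H.NeBot ∧ (∀ W ∈ 𝓝 (0 : X), ∃ A ∈ H, ∀ a ∈ A, ∀ b ∈ A, a - b ∈ W) ∧
      map p H ≤ F ∧ ∃ x₀ ∈ S, ∀ᶠ x in H, x - x₀ ∈ U := by
  obtain ⟨V, hV, hV0, hVadd, hVi⟩ := exists_seq_nhds_zero i hi hU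
  choose A' hA'F hA' using fun n => hF _ (hp _ (hV n))
  have hFne : ∀ A ∈ F, A.Nonempty := fun A hA =>
    let ⟨x, _, hx⟩ := hS A hA
    ⟨p x, hx⟩
  let A : ℕ → Set Z := fun n => Nat.rec (A' 0) (fun n B => B ∩ A' (n + 1)) n
  have hAF : ∀ n, A n ∈ F := fun n => by
    induction n with
    | zero => exact hA'F 0
    | succ n ih => exact inter_mem ih (hA'F _)
  have hAA' : ∀ n, A n ⊆ A' n := fun n => by
    cases n with
    | zero => exact subset_rfl
    | succ n => exact Set.inter_subset_right
  have hAs : ∀ n, A (n + 1) ⊆ A n := fun n => Set.inter_subset_left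
  obtain ⟨x₀, hx₀S, hx₀⟩ := hS _ (hAF 0)
  -- Two points of `A n` differ by an element of `p '' V n`, so a lift of one can be moved by an
  -- element of `V n` to a lift of the other.
  have step : ∀ n (x : {x // p x ∈ A n}), ∃ x' : {x // p x ∈ A (n + 1)}, x'.1 - x.1 ∈ V n := by
    rintro n ⟨x, hx⟩
    obtain ⟨z, hz⟩ := hFne _ (hAF (n + 1))
    obtain ⟨v, hv, hvz⟩ := hA' n z (hAA' n (hAs n hz)) (p x) (hAA' n hx)
    exact ⟨⟨x + v, by rwa [map_add, hvz, add_sub_cancel]⟩, by simpa using hv⟩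
  choose f hf using step
  let x : ∀ n, {x // p x ∈ A n} := fun n => Nat.rec ⟨x₀, hx₀⟩ f n
  have hx : ∀ n, (x (n + 1)).1 - (x n).1 ∈ V n := fun n => hf n (x n)
  -- `B n = x n + V n + V n`. The second summand absorbs the step from `x n` to `x (n + 1)`, which
  -- makes `B` decreasing.
  let B : ℕ → Set X := fun n => {w | ∃ a ∈ V n, ∃ b ∈ V n, w - (x n).1 = a + b}
  have hB : Antitone B := by
    refine antitone_nat_of_succ_le fun n => ?_
    rintro w ⟨a, ha, b, hb, hw⟩
    refine ⟨a + b, hVadd n a ha b hb, _, hx n, ?_⟩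
    rw [← hw]
    abel
  -- The filter must refine both `comap p F`, which controls the image in `Z`, and the sets `B n`,
  -- which control the direction of `Y`. The sequence `x n` alone need not be Cauchy in `X`.
  have hbasis : (comap p F ⊓ ⨅ n, 𝓟 (B n)).HasBasis (fun q : Set Z × ℕ => q.1 ∈ F ∧ True)
      (fun q => p ⁻¹' q.1 ∩ B q.2) :=
    (F.basis_sets.comap p).inf (hasBasis_iInf_principal hB.directed_ge)
  refine ⟨comap p F ⊓ ⨅ n, 𝓟 (B n), hbasis.neBot_iff.2 ?_, fun W hW => ?_,
    map_le_iff_le_comap.2 inf_le_left, x₀, hx₀S, ?_⟩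
  · rintro ⟨C, n⟩ ⟨hC, -⟩
    obtain ⟨z, hzC, hz⟩ := hFne _ (inter_mem hC (hAF n))
    obtain ⟨v, hv, hvz⟩ := hA' n z (hAA' n hz) (p (x n).1) (hAA' n (x n).2)
    refine ⟨(x n).1 + v, ?_, v, hv, 0, mem_of_mem_nhds (hV n), by simp⟩
    change p _ ∈ C
    rwa [map_add, hvz, add_sub_cancel]
  · obtain ⟨W', hW', hWW'⟩ := exists_nhds_zero_half hW
    obtain ⟨n, hn⟩ := hVi W' hW'
    obtain ⟨C, hC, hCn⟩ := hF _ (hp _ (inter_mem hW' (hV n)))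
    refine ⟨_, hbasis.mem_of_mem (i := (C, n)) ⟨hC, trivial⟩, ?_⟩
    rintro w ⟨hwC, a, ha, b, hb, hw⟩ w' ⟨hwC', a', ha', b', hb', hw'⟩
    -- After subtracting a small `e` with the same image as `w - w'`, the difference lies in `Y` and
    -- is a five-term combination from `V n`, hence small.
    obtain ⟨e, ⟨heW, heV⟩, he⟩ := hCn _ hwC _ hwC'
    obtain ⟨y, hy⟩ := hex (w - w' - e) (by rw [map_sub, map_sub, he, sub_self])
    have hyW := hn a ha b hb a' ha' b' hb' e heV y (by rw [hy, ← hw, ← hw']; abel)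
    have := hWW' _ hyW _ heW
    rwa [hy, sub_add_cancel] at this
  · refine mem_of_superset (hbasis.mem_of_mem (i := (Set.univ, 0)) ⟨univ_mem, trivial⟩) ?_
    rintro w ⟨-, a, ha, b, hb, hw⟩
    change w - (x 0).1 ∈ U
    rw [hw]
    exact hV0 a ha b hb

end Lifting

/-! ### Exactness in terms of neighborhoods -/

section Exact

variable {X Y Z : Type*} [AddCommGroup X] [Module ℝ X] [TopologicalSpace X]
  [AddCommGroup Y] [Module ℝ Y] [TopologicalSpace Y]
  [AddCommGroup Z] [Module ℝ Z] [TopologicalSpace Z]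

theorem exists_nhds_sub_mem (i : Y →L[ℝ] X) (p : X →L[ℝ] Z) (hp : IsOpenMap p)
    (hex : Function.Exact i p) {U : Set X} (hU : U ∈ 𝓝 0) :
    ∃ N ∈ 𝓝 (0 : Z), ∀ x, p x ∈ N → ∃ y, x - i y ∈ U := by
  refine ⟨p '' U, by simpa using hp.image_mem_nhds hU, ?_⟩
  rintro x ⟨u, hu, hux⟩
  obtain ⟨y, hy⟩ := (hex (x - u)).1 (by rw [map_sub, hux, sub_self])
  exact ⟨y, by rwa [hy, sub_sub_cancel]⟩

end Exact

/-! ### Completing the middle space -/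

section CompletedExtension

open UniformSpace Filter

variable {X Y Z : Type*}
  [AddCommGroup X] [Module ℝ X] [UniformSpace X] [IsUniformAddGroup X] [ContinuousSMul ℝ X]
  [AddCommGroup Y] [Module ℝ Y] [UniformSpace Y] [IsUniformAddGroup Y] [CompleteSpace Y]
  [AddCommGroup Z] [Module ℝ Z] [UniformSpace Z] [IsUniformAddGroup Z] [ContinuousSMul ℝ Z]

theorem isUniformInducing_completionInclusion : IsUniformInducing (completionInclusion Z) :=
  Completion.isUniformInducing_coe Z

theorem denseRange_completionInclusion : DenseRange (completionInclusion Z) :=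
  Completion.denseRange_coe

theorem completionInclusion_injective [T2Space Z] :
    Function.Injective (completionInclusion Z) :=
  Completion.coe_injective Z

/-- The kernel of the extension of `f` to the completion is the kernel of `f`, if the latter is
complete and `f` is open onto its image. -/
theorem exists_completionInclusion_eq {W : Type*} [AddCommGroup W] [Module ℝ W]
    [TopologicalSpace W] (i : Y →L[ℝ] X) (hi : IsInducing i)
    (g : Completion X →L[ℝ] W)
    (hg : ∀ U ∈ 𝓝 (0 : X), ∃ N ∈ 𝓝 (0 : W), ∀ x, g (completionInclusion X x) ∈ N →
      ∃ y, x - i y ∈ U)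
    {ξ : Completion X} (hξ : g ξ = 0) : ∃ y, completionInclusion X (i y) = ξ := by
  have hind : IsUniformInducing ((completionInclusion X).comp i) :=
    AddMonoidHom.isUniformInducing_of_isInducing 
      (isUniformInducing_completionInclusion.isInducing.comp hi :)
  have hclosed : IsClosed (Set.range ((completionInclusion X).comp i)) :=
    hind.isComplete_range.isClosed
  refine hclosed.closure_subset ?_
  rw [mem_closure_iff_nhds_zero]
  intro U hU
  obtain ⟨V, hV, hVU⟩ := exists_nhds_half_neg hU
  obtain ⟨N, hN, hNV⟩ := hg (completionInclusion X ⁻¹' V)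
    ((completionInclusion X).continuous.continuousAt.preimage_mem_nhds (by simpa using hV))
  have h1 : g ⁻¹' N ∈ 𝓝 ξ := g.continuous.continuousAt.preimage_mem_nhds (by rwa [hξ])
  have h2 : (fun η => η - ξ) ⁻¹' V ∈ 𝓝 ξ :=
    (continuous_sub_right ξ).continuousAt.preimage_mem_nhds (by simpa using hV)
  -- Take `x` in `X` close to `ξ`, so that `g x` is small. Then `x` is close to some `i y`, and
  -- therefore `i y` is close to `ξ`.
  obtain ⟨_, ⟨x, rfl⟩, hxN, hxV⟩ :=
    denseRange_completionInclusion.inter_nhds_nonempty (inter_mem h1 h2)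
  obtain ⟨y, hy⟩ := hNV x hxN
  refine ⟨_, ⟨y, rfl⟩, ?_⟩
  have := hVU _ hxV _ hy
  rw [map_sub] at this
  simpa using this

/-- Completeness is a three-space property. -/
theorem completeSpace_of_exact {W : Type*} [AddCommGroup W] [Module ℝ W] [UniformSpace W]
    [IsUniformAddGroup W] [ContinuousSMul ℝ W] [T2Space W] [CompleteSpace W]
    (i : Y →L[ℝ] X) (hi : IsInducing i)
    (p : X →L[ℝ] W) (hp : IsOpenQuotientMap p) (hex : Function.Exact i p) : CompleteSpace X := by
  let g : Completion X →L[ℝ] W := p.extend (completionInclusion X)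
  have hg : ∀ x, g (completionInclusion X x) = p x :=
    p.extend_eq denseRange_completionInclusion isUniformInducing_completionInclusion
  -- Lifting `g ξ` to `x` in `X` leaves `ξ - x` in the kernel of `g`, which comes from `Y`. So the
  -- completion adds no points.
  have hsurj : Function.Surjective (completionInclusion X) := fun ξ => by
    obtain ⟨x, hx⟩ := hp.surjective (g ξ)
    obtain ⟨y, hy⟩ := exists_completionInclusion_eq i hi g (ξ := ξ - completionInclusion X x)
      (fun U hU => by simpa only [hg] using exists_nhds_sub_mem i p hp.isOpenMap hex hU)
      (by rw [map_sub, hg, hx, sub_self])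
    exact ⟨x + i y, by rw [map_add, hy, add_sub_cancel]⟩
  exact (isUniformInducing_completionInclusion.completeSpace_congr hsurj).2 inferInstance

/-- The completion of a continuous linear map. -/
noncomputable def completionMap (p : X →L[ℝ] Z) : Completion X →L[ℝ] Completion Z :=
  ((completionInclusion Z).comp p).extend (completionInclusion X)

theorem completionMap_apply (p : X →L[ℝ] Z) (x : X) :
    completionMap p (completionInclusion X x) = completionInclusion Z (p x) :=
  ContinuousLinearMap.extend_eq _ denseRange_completionInclusion
    isUniformInducing_completionInclusion x

/-- The trace on `Z` of the neighborhoods of `ζ` is a Cauchy filter; the limit in `ϱX` of a lifted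
filter is `ξ`. Taking `S` to be everything gives surjectivity, while a small `S` also locates `ξ`,
which gives openness. -/
theorem exists_completionMap_eq {Y : Type*} [AddCommGroup Y] [Module ℝ Y] [TopologicalSpace Y]
    [FirstCountableTopology Y] (i : Y →L[ℝ] X) (hi : IsInducing i)
    (p : X →L[ℝ] Z) (hp : IsOpenMap p) (hex : Function.Exact i p) {S : Set X} {U : Set X}
    (hU : U ∈ 𝓝 0) {ζ : Completion Z} (hζ : ζ ∈ closure (completionInclusion Z '' (p '' S))) :
    ∃ ξ, completionMap p ξ = ζ ∧
      ∃ x₀ ∈ S, ξ ∈ closure (completionInclusion X '' {x | x - x₀ ∈ U}) := by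
  let F : Filter Z := comap (completionInclusion Z) (𝓝 ζ)
  have hF : ∀ N ∈ 𝓝 (0 : Z), ∃ A ∈ F, ∀ a ∈ A, ∀ b ∈ A, a - b ∈ N := fun N hN => by
    rw [isUniformInducing_completionInclusion.isInducing.nhds_eq_comap, map_zero] at hN
    obtain ⟨M, hM, hMN⟩ := hN
    have h : (fun q : Completion Z × Completion Z => q.1 - q.2) ⁻¹' M ∈ 𝓝 (ζ, ζ) :=
      continuous_sub.continuousAt.preimage_mem_nhds (by simpa using hM)
    rw [nhds_prod_eq, mem_prod_self_iff] at h
    obtain ⟨A, hA, hAM⟩ := h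
    refine ⟨_, preimage_mem_comap hA, fun a ha b hb => hMN ?_⟩
    have := hAM (Set.mk_mem_prod ha hb)
    rwa [Set.mem_preimage, map_sub]
  have hS : ∀ A ∈ F, ∃ x ∈ S, p x ∈ A := by
    rintro A ⟨M, hM, hMA⟩
    obtain ⟨_, hz, _, ⟨x, hx, rfl⟩, rfl⟩ := mem_closure_iff_nhds.1 hζ M hM
    exact ⟨x, hx, hMA hz⟩
  obtain ⟨H, hne, hH, hHF, x₀, hx₀, hHU⟩ := exists_cauchy_lift (i : Y →+ X) hi (p : X →+ Z)
    (fun V hV => by simpa using hp.image_mem_nhds hV) (fun x hx => (hex x).1 hx) F hF hS hU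
  have hHc : Cauchy H := by
    refine ⟨hne, ?_⟩
    rw [uniformity_eq_comap_nhds_zero, ← map_le_iff_le_comap]
    intro W hW
    obtain ⟨A, hA, hAW⟩ := hH W hW
    refine mem_map.2 (mem_of_superset (prod_mem_prod hA hA) ?_)
    rintro ⟨a, b⟩ ⟨ha, hb⟩
    exact hAW _ hb _ ha
  obtain ⟨ξ, hξ⟩ := CompleteSpace.complete
    (hHc.map isUniformInducing_completionInclusion.uniformContinuous)
  refine ⟨ξ, ?_, x₀, hx₀, mem_closure_of_tendsto hξ ?_⟩
  · have h1 : Tendsto (fun x => completionMap p (completionInclusion X x)) H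
        (𝓝 (completionMap p ξ)) := ((completionMap p).continuous.tendsto ξ).comp hξ
    simp only [completionMap_apply] at h1
    exact tendsto_nhds_unique h1 (tendsto_comap.comp hHF)
  · exact hHU.mono fun x hx => ⟨x, hx, rfl⟩

theorem isOpenQuotientMap_completionMap {Y : Type*} [AddCommGroup Y] [Module ℝ Y] [TopologicalSpace Y]
    [FirstCountableTopology Y] (i : Y →L[ℝ] X)
    (hi : IsInducing i) (p : X →L[ℝ] Z) (hp : IsOpenQuotientMap p) (hex : Function.Exact i p) :
    IsOpenQuotientMap (completionMap p) := by
  refine ⟨fun ζ => ?_, (completionMap p).continuous, ?_⟩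
  · obtain ⟨ξ, hξ, -⟩ := exists_completionMap_eq i hi p hp.isOpenMap hex (S := Set.univ) univ_mem
      (ζ := ζ) (by
        rw [Set.image_univ, hp.surjective.range_eq, Set.image_univ]
        exact denseRange_completionInclusion ζ)
    exact ⟨ξ, hξ⟩
  · rw [IsTopologicalAddGroup.isOpenMap_iff_nhds_zero]
    intro O hO
    -- A closed neighborhood is needed because `ξ` is only known to lie in a closure.
    obtain ⟨C, hC, hCc, hCO⟩ := exists_mem_nhds_isClosed_subset (mem_map.1 hO)
    obtain ⟨V, hV, hVC⟩ := exists_nhds_zero_half hC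
    have hU : completionInclusion X ⁻¹' V ∈ 𝓝 0 :=
      (completionInclusion X).continuous.continuousAt.preimage_mem_nhds (by simpa using hV)
    have hN : p '' (completionInclusion X ⁻¹' V) ∈ 𝓝 0 := by
      simpa using hp.isOpenMap.image_mem_nhds hU
    -- In a completion, closures of neighborhoods of `0` in the dense subspace are neighborhoods of
    -- `0`.
    have hcl := (isUniformInducing_completionInclusion.isDenseInducing
      (denseRange_completionInclusion (Z := Z))).closure_image_mem_nhds hN
    rw [map_zero] at hcl
    filter_upwards [hcl] with ζ hζ
    obtain ⟨ξ, rfl, x₀, hx₀, hξ⟩ := exists_completionMap_eq i hi p hp.isOpenMap hex hU hζ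
    refine hCO (hCc.closure_subset_iff.2 ?_ hξ)
    rintro _ ⟨x, hx, rfl⟩
    have := hVC _ hx _ hx₀
    rwa [← map_add, sub_add_cancel] at this

theorem exact_completionMap (i : Y →L[ℝ] X) (hi : IsInducing i) (p : X →L[ℝ] Z)
    (hp : IsOpenMap p) (hex : Function.Exact i p) :
    Function.Exact ((completionInclusion X).comp i) (completionMap p) := by
  intro ξ
  constructor
  · refine exists_completionInclusion_eq i hi (completionMap p) fun U hU => ?_
    obtain ⟨N, hN, h⟩ := exists_nhds_sub_mem i p hp hex hU
    rw [isUniformInducing_completionInclusion.isInducing.nhds_eq_comap, map_zero] at hN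
    obtain ⟨M, hM, hMN⟩ := hN
    exact ⟨M, hM, fun x hx => h x (hMN (by rwa [completionMap_apply] at hx))⟩
  · rintro ⟨y, rfl⟩
    change completionMap p (completionInclusion X (i y)) = 0
    rw [completionMap_apply, (hex _).2 ⟨y, rfl⟩, map_zero]

end CompletedExtension

/-! ### Bijectivity of the pull-back on classes -/

namespace TVSExtension

open UniformSpace

/-- An extension by a complete first countable space, after completion of its middle space. -/
noncomputable def completion {X : Type (max u v)} {Z : Type v} {Y : Type u}
    [AddCommGroup X] [Module ℝ X] [UniformSpace X] [IsUniformAddGroup X] [ContinuousSMul ℝ X]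
    [T2Space X]
    [AddCommGroup Z] [Module ℝ Z] [UniformSpace Z] [IsUniformAddGroup Z] [ContinuousSMul ℝ Z]
    [AddCommGroup Y] [Module ℝ Y] [UniformSpace Y] [IsUniformAddGroup Y]
    [CompleteSpace Y] [FirstCountableTopology Y] (i : Y →L[ℝ] X) (hi : IsEmbedding i)
    (p : X →L[ℝ] Z) (hp : IsOpenQuotientMap p) (hex : Function.Exact i p) :
    TVSExtension (Completion Z) Y where
  X := Completion X
  incl := (completionInclusion X).comp i
  proj := completionMap p
  isEmbedding := ⟨isUniformInducing_completionInclusion.isInducing.comp hi.isInducing,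
    completionInclusion_injective.comp hi.injective⟩
  isOpenQuotientMap := isOpenQuotientMap_completionMap i hi.isInducing p hp hex
  exact := exact_completionMap i hi.isInducing p hp.isOpenMap hex

section

variable {Z : Type v} [AddCommGroup Z] [Module ℝ Z] [UniformSpace Z] [IsUniformAddGroup Z]
  [ContinuousSMul ℝ Z] [T2Space Z]
  {W : Type v} [AddCommGroup W] [Module ℝ W] [UniformSpace W] [IsUniformAddGroup W]
  [ContinuousSMul ℝ W] [T2Space W] [CompleteSpace W]
  {Y : Type u} [AddCommGroup Y] [Module ℝ Y] [UniformSpace Y] [IsUniformAddGroup Y]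
  [CompleteSpace Y]

theorem exists_equivalent_pullback [FirstCountableTopology Y] (E : TVSExtension Z Y) :
    ∃ E' : TVSExtension (Completion Z) Y, E.Equivalent (E'.pullback (completionInclusion Z)) := by
  let : UniformSpace E.X := IsTopologicalAddGroup.rightUniformSpace E.X
  have : IsUniformAddGroup E.X := isUniformAddGroup_of_addCommGroup
  refine ⟨completion E.incl E.isEmbedding E.proj E.isOpenQuotientMap E.exact,
    pullbackLift _ _ (completionInclusion E.X) E.proj (completionMap_apply E.proj), ?_, ?_⟩
  · intro y
    exact Subtype.ext (Prod.ext rfl (E.proj_incl y))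
  · intro x
    rfl

theorem equivalent_of_pullback_equivalent {E E' : TVSExtension W Y} {t : Z →L[ℝ] W}
    (ht : IsInducing t) (htd : DenseRange t) (h : (E.pullback t).Equivalent (E'.pullback t)) :
    E.Equivalent E' := by
  let : UniformSpace E.X := IsTopologicalAddGroup.rightUniformSpace E.X
  have : IsUniformAddGroup E.X := isUniformAddGroup_of_addCommGroup
  let : UniformSpace E'.X := IsTopologicalAddGroup.rightUniformSpace E'.X
  have : IsUniformAddGroup E'.X := isUniformAddGroup_of_addCommGroup
  let : UniformSpace (E.pullback t).X := IsTopologicalAddGroup.rightUniformSpace _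
  have : IsUniformAddGroup (E.pullback t).X := isUniformAddGroup_of_addCommGroup
  -- The extension by continuity takes its values here, so completeness of this space is what is
  -- needed.
  have : CompleteSpace E'.X :=
    completeSpace_of_exact E'.incl E'.isEmbedding.isInducing E'.proj E'.isOpenQuotientMap E'.exact
  obtain ⟨T, hT, hT'⟩ := h
  have hj : IsUniformInducing (E.pullbackFst t) :=
    AddMonoidHom.isUniformInducing_of_isInducing (E.isInducing_pullbackFst ht)
  have hjd : DenseRange (E.pullbackFst t) := by
    rw [DenseRange, range_pullbackFst]
    -- The preimage of a dense set under an open map is dense.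
    exact htd.preimage E.isOpenQuotientMap.isOpenMap
  have hext := ((E'.pullbackFst t).comp T).extend_eq hjd hj
  refine ⟨((E'.pullbackFst t).comp T).extend (E.pullbackFst t), fun y => ?_, fun x => ?_⟩
  · refine (hext ((E.pullback t).incl y)).trans ?_
    change E'.pullbackFst t (T _) = _
    rw [hT]
    rfl
  · refine hjd.induction_on x (isClosed_eq (by fun_prop) (by fun_prop)) fun p => ?_
    rw [hext]
    refine (E'.proj_eq_of_mem_pullback t (T p)).trans ?_
    refine Eq.trans ?_ (E.proj_eq_of_mem_pullback t p).symm
    exact congrArg t (hT' p)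

end

end TVSExtension

theorem theorem3p7
    (Z : Type v) [AddCommGroup Z] [Module ℝ Z] [UniformSpace Z] [IsUniformAddGroup Z]
    [ContinuousSMul ℝ Z] [T2Space Z]
    (Y : Type u) [AddCommGroup Y] [Module ℝ Y] [UniformSpace Y] [IsUniformAddGroup Y]
    [ContinuousSMul ℝ Y] [CompleteSpace Y] [TopologicalSpace.MetrizableSpace Y] :
    ∃ e : ExtTVS Z Y ≃+ ExtTVS (UniformSpace.Completion Z) Y,
      ∀ E : TVSExtension (UniformSpace.Completion Z) Y,
        e.symm (ExtTVS.mk E) = ExtTVS.mk (E.pullback (completionInclusion Z)) := by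
  have hb : Function.Bijective (ExtTVS.pullback (Y := Y) (completionInclusion Z)) := by
    constructor
    · rintro ⟨E⟩ ⟨E'⟩ h
      exact Quotient.sound (TVSExtension.equivalent_of_pullback_equivalent
        isUniformInducing_completionInclusion.isInducing denseRange_completionInclusion
        (Quotient.exact h))
    · rintro ⟨E⟩
      obtain ⟨E', hE'⟩ := E.exists_equivalent_pullback
      exact ⟨ExtTVS.mk E', (Quotient.sound hE').symm⟩
  exact ⟨(AddEquiv.ofBijective (ExtTVS.pullback (completionInclusion Z)) hb).symm, fun _ => rfl⟩
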